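/- **The Herlihy–Wing queue (HWQ).** The shared state is a counter $\mathit{back}$ (initially $0$) and an array $\mathit{items}$ indexed by $\mathbb N$ (all slots initially $\mathsf{null}$). A call $\mathsf{enq}(v)$ atomically executes $i:=\mathit{back}{+}{+}$ (step $\mathsf{enqI}$), then $\mathit{items}[i]:=v$ (step $\mathsf{enqW}$), then returns. A call $\mathsf{deq}()$ repeats the following loop: atomically choose any $\mathit{range}$ with $0\le \mathit{range}<\mathit{back}$ and set $j:=0$; while $j<\mathit{range}$, atomically swap $\mathit{items}[j]$ with $\mathsf{null}$, return the value found if it is not $\mathsf{null}$, and otherwise increment $j$. An iteration of the outer loop that returns is denoted $\mathsf{deqT}$, one that restarts $\mathsf{deqF}$. (Everything below holds as well when the inner guard is $j\le \mathit{range}$.) Values are taken from an arbitrary set, thread ids from an infinite totally ordered set; every thread performs at most one call. A *trace* is the sequence of thread-indexed steps of an execution, under arbitrary interleaving of finitely many calls, in which every started call has returned. A trace is *linearizable* if each of its threads can be assigned a position of the trace, not before the first step and before the return of its call, such that the operations, in the order of these positions (threads at the same position being ordered in some way), form a history of a sequential FIFO queue that is initially empty, in which a dequeue is only possible when the queue is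 non-empty. Let $E$ be the set of sequences of steps denoted by $$\left(\mathsf{deqF}^*\cdot \mathsf{enqI}^{+}\cdot \mathsf{enqW}^*\cdot \mathsf{deqT}^*\right)^*,$$ where $\mathsf{deqF}$ and $\mathsf{deqT}$ stand for entire iterations executed without interruption, $\mathsf{enqW}$ includes the return of its call, and inside a block the repetitions of $\mathsf{deqF},\mathsf{enqI},\mathsf{deqT}$ are ordered by increasing thread id and those of $\mathsf{enqW}$ by increasing slot. The *traces of the quotient expression* are the traces of the HWQ that belong to $E$ and in which the writes preceding a successful dequeue are ordered by slot, in the following sense: whenever an $\mathsf{enqW}$ on slot $i$ comes before an $\mathsf{enqW}$ on a slot $i'<i$ and both come before a swap that finds a value, the value in slot $i$ has been removed before that swap. **Theorem.** 1. The HWQ is linearizable: all its traces are linearizable. 2. Every trace of the quotient expression is linearizable with fixed linearization points: the linearization point of an enqueue is its $\mathsf{enqW}$ step, and that of a dequeue is its $\mathsf{deqT}$ step (the swap in it that finds a value). 3. For arbitrary traces, linearization points depend on the future: if there are three distinct values, there are traces $\pi\sigma_1$ and $\pi\sigma_2$ with a common prefix $\pi$, and two enqueues by threads $t_1,t_2$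 that have both returned within $\pi$, such that $t_1$ precedes $t_2$ in every linearization of $\pi\sigma_1$, while $t_2$ precedes $t_1$ in every linearization of $\pi\sigma_2$. -/

import Mathlib

namespace HerlihyWing

/-! ## The queue as a concurrent object -/

/-- The two readings of the guard of the scanning loop of a dequeue: `while (j < range)` and
`while (j <= range)`. -/
inductive LoopGuard
  | lt
  | le

/-- The guard of the scanning loop holds at index `j` with bound `range = r`. -/
def LoopGuard.Holds : LoopGuard → ℕ → ℕ → Prop
  | .lt, j, r => j < r
  | .le, j, r => j ≤ r

/-- Method calls with their arguments. -/
inductive Call (V : Type*)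
  | enq (v : V)
  | deq

/-- Labels of the atomic steps.  They record the values that are read and written, so a trace
determines the execution it comes from. Tests and assignments that touch only local variables are
merged into the neighbouring step. -/
inductive Label (V : Type*)
  /-- `i := back++` in a call `enq(v)`; the value read is `i`. -/
  | enqI (v : V) (i : ℕ)
  /-- `items[i] = v` -/
  | enqW (i : ℕ) (v : V)
  /-- return of an enqueue -/
  | enqRet
  /-- `assume 0 <= range < back; j = 0`, with `range = r` chosen -/
  | deqRead (r : ℕ)
  /-- `v := swap(items[j], null)`, with the value found (`none` is `null`); if it is `null`, the
  step includes `j++` -/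
  | deqSwap (j : ℕ) (found : Option V)
  /-- the scan ended without a value, back to the head of the outer loop -/
  | deqRestart
  /-- `return v` of a dequeue -/
  | deqRet (v : V)

def Label.IsReturn {V : Type*} : Label V → Prop
  | .enqRet => True
  | .deqRet _ => True
  | _ => False

/-- Local state of a thread together with its program point. -/
inductive LocalState (V : Type*)
  | enqStart (v : V)
  | enqReserved (v : V) (i : ℕ)
  | enqWritten
  | deqHead
  | deqScan (range j : ℕ)
  | deqFound (v : V)
  /-- the method has returned -/
  | finished

/-- The shared state: the counter `back` and the array `items` (`none` is `null`). -/
structure Shared (V : Type*) where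
  back : ℕ
  items : ℕ → Option V

def Shared.init (V : Type*) : Shared V := ⟨0, fun _ => none⟩

/-- The program point at which a call starts. -/
def Call.entry {V : Type*} : Call V → LocalState V
  | .enq v => .enqStart v
  | .deq => .deqHead

/-- One step of a single thread. -/
inductive ThreadStep {V : Type*} (g : LoopGuard) :
    LocalState V → Shared V → Label V → LocalState V → Shared V → Prop
  | enqI (v : V) (s : Shared V) :
      ThreadStep g (.enqStart v) s (.enqI v s.back)
        (.enqReserved v s.back) { s with back := s.back + 1 }
  | enqW (v : V) (i : ℕ) (s : Shared V) :
      ThreadStep g (.enqReserved v i) s (.enqW i v)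
        .enqWritten { s with items := Function.update s.items i (some v) }
  | enqRet (s : Shared V) : ThreadStep g .enqWritten s .enqRet .finished s
  | deqRead (r : ℕ) (s : Shared V) (hr : r < s.back) :
      ThreadStep g .deqHead s (.deqRead r) (.deqScan r 0) s
  | deqSwapNull (r j : ℕ) (s : Shared V) (hj : g.Holds j r) (h : s.items j = none) :
      ThreadStep g (.deqScan r j) s (.deqSwap j none) (.deqScan r (j + 1))
        { s with items := Function.update s.items j none }
  | deqSwapVal (r j : ℕ) (v : V) (s : Shared V) (hj : g.Holds j r) (h : s.items j = some v) :
      ThreadStep g (.deqScan r j) s (.deqSwap j (some v)) (.deqFound v)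
        { s with items := Function.update s.items j none }
  | deqRestart (r j : ℕ) (s : Shared V) (hj : ¬ g.Holds j r) :
      ThreadStep g (.deqScan r j) s .deqRestart .deqHead s
  | deqRet (v : V) (s : Shared V) : ThreadStep g (.deqFound v) s (.deqRet v) .finished s

/-- An environment: which threads call which method (`none`: the thread calls nothing).  Every
thread performs at most one call. -/
abbrev Env (T V : Type*) := T → Option (Call V)

/-- Shared state and local state of every thread that has started. -/
structure Config (T V : Type*) where
  shared : Shared V
  loc : T → Option (LocalState V)

def Config.init (T V : Type*) : Config T V := ⟨Shared.init V, fun _ => none⟩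

/-- Local state from which thread `t` takes its next step.  There is no separate invocation step:
the first instruction of a call plays this role. -/
def Config.current {T V : Type*} (env : Env T V) (c : Config T V) (t : T) :
    Option (LocalState V) :=
  (c.loc t).or ((env t).map Call.entry)

/-- A trace is a sequence of labels indexed by threads. -/
abbrev Trace (T V : Type*) := List (T × Label V)

/-- Executions of the queue in an environment: interleavings of steps of the threads. -/
inductive Exec {T V : Type*} [DecidableEq T] (g : LoopGuard) (env : Env T V) :
    Config T V → Trace T V → Config T V → Prop
  | nil (c : Config T V) : Exec g env c [] c
  | cons {c c' : Config T V} {t : T} {a : Label V} {l l' : LocalState V} {s' : Shared V}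
      {τ : Trace T V} (hl : c.current env t = some l) (hs : ThreadStep g l c.shared a l' s')
      (h : Exec g env ⟨s', Function.update c.loc t (some l')⟩ τ c') :
      Exec g env c ((t, a) :: τ) c'

/-- Every thread that has started has returned. -/
def Config.Final {T V : Type*} (c : Config T V) : Prop :=
  ∀ t l, c.loc t = some l → l = .finished

/-- The semantics of the queue: traces of completed executions in finite environments. -/
def traces (T V : Type*) [DecidableEq T] (g : LoopGuard) : Set (Trace T V) :=
  {τ | ∃ env : Env T V, {t | env t ≠ none}.Finite ∧
    ∃ c : Config T V, Exec g env (Config.init T V) τ c ∧ c.Final}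

/-! ## Linearizability -/

/-- Operation symbols `enq(v)/()` and `deq()/v`. -/
inductive Op (V : Type*)
  | enq (v : V)
  | deq (v : V)

/-- `QueueRun q h`: the operations `h` can be executed one after another on a FIFO queue with
contents `q`. -/
def QueueRun {V : Type*} : List V → List (Op V) → Prop
  | _, [] => True
  | q, .enq v :: h => QueueRun (q ++ [v]) h
  | q, .deq v :: h => ∃ q', q = v :: q' ∧ QueueRun q' h

/-- The sequential specification: histories of a FIFO queue that is initially empty. -/
def queueSpec (V : Type*) : Set (List (Op V)) := {h | QueueRun [] h}

/-- `OpOf τ t o`: in the trace `τ` the thread `t` performs the operation `o`. -/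
def OpOf {T V : Type*} (τ : Trace T V) (t : T) : Op V → Prop
  | .enq v => ∃ i, (t, Label.enqI v i) ∈ τ
  | .deq v => (t, Label.deqRet v) ∈ τ

/-- The mapping `lp` of threads to positions of `τ`, with `L` the threads of `τ` in the order of
these positions, is a linearization of `τ` with respect to the FIFO queue: every position is not
before the first step and before the return of its thread, and the resulting sequence of operations
belongs to the specification.  Several threads may be linearized at one position; `L` then fixes
their order. -/
structure IsLinearization {T V : Type*} (τ : Trace T V) (lp : T → ℕ) (L : List T) : Prop where
  nodup : L.Nodup
  mem_iff : ∀ t, t ∈ L ↔ ∃ a, (t, a) ∈ τ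
  sorted : L.Pairwise (fun t u => lp t ≤ lp u)
  after_start : ∀ t ∈ L, ∃ k a, k ≤ lp t ∧ τ[k]? = some (t, a)
  before_return : ∀ t ∈ L, ∃ k a, lp t < k ∧ τ[k]? = some (t, a) ∧ a.IsReturn
  legal : ∃ ops : List (Op V), List.Forall₂ (OpOf τ) L ops ∧ ops ∈ queueSpec V

def Linearizable {T V : Type*} (τ : Trace T V) : Prop :=
  ∃ (lp : T → ℕ) (L : List T), IsLinearization τ lp L

/-- `lp` sends every thread of `τ` to the step at which it writes its slot (enqueue) or at which
its swap finds a value (the effect of its successful iteration, for a dequeue). -/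
def IsFixedPoints {T V : Type*} (τ : Trace T V) (lp : T → ℕ) : Prop :=
  ∀ t, (∃ a, (t, a) ∈ τ) →
    (∃ i v, τ[lp t]? = some (t, Label.enqW i v)) ∨
    (∃ j v, τ[lp t]? = some (t, Label.deqSwap j (some v)))

/-! ## The quotient expression -/

/-- Finite concatenations of words taken from members `W k` of a family of languages, at strictly
increasing indices `k`. -/
def orderedStar {ι α : Type*} [LT ι] (W : ι → Language α) : Language α :=
  {w | ∃ l : List (ι × List α), l.Pairwise (fun x y => x.1 < y.1) ∧
    (∀ x ∈ l, x.2 ∈ W x.1) ∧ w = (l.map Prod.snd).flatten}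

/-- The same, with at least one word. -/
def orderedPlus {ι α : Type*} [LT ι] (W : ι → Language α) : Language α :=
  {w | ∃ l : List (ι × List α), l ≠ [] ∧ l.Pairwise (fun x y => x.1 < y.1) ∧
    (∀ x ∈ l, x.2 ∈ W x.1) ∧ w = (l.map Prod.snd).flatten}

/-- `enqI` by thread `t`. -/
def enqI {T V : Type*} (t : T) : Language (T × Label V) :=
  {w | ∃ v i, w = [(t, .enqI v i)]}

/-- `enqW` on slot `i`, by any thread, with the return that ends the call. -/
def enqW {T V : Type*} (i : ℕ) : Language (T × Label V) :=
  {w | ∃ t v, w = [(t, .enqW i v), (t, .enqRet)]}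

/-- The first `k` swaps of an iteration, all of which find `null`. -/
def nullSwaps {T V : Type*} (t : T) (k : ℕ) : Trace T V :=
  (List.range k).map fun j => (t, .deqSwap j none)

/-- `deqF`: an entire iteration of the outer loop of a dequeue by `t` that restarts. -/
def deqF {T V : Type*} (t : T) : Language (T × Label V) :=
  {w | ∃ r k, w = (t, .deqRead r) :: nullSwaps t k ++ [(t, .deqRestart)]}

/-- `deqT`: an entire iteration of the outer loop of a dequeue by `t` that returns. -/
def deqT {T V : Type*} (t : T) : Language (T × Label V) :=
  {w | ∃ r k v, w = (t, .deqRead r) :: nullSwaps t k ++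
    [(t, .deqSwap k (some v)), (t, .deqRet v)]}

open scoped Computability in
/-- The interpretation of `(deqF* · enqI⁺ · enqW* · deqT*)*`.  Inside one block the repetitions are
ordered by thread, those of `enqW` by the slot that is written. -/
def quotientExpr (T V : Type*) [LinearOrder T] : Language (T × Label V) :=
  (orderedStar deqF * orderedPlus enqI * orderedStar enqW * orderedStar deqT)∗

/-- The writes that precede a successful dequeue are ordered by slot: if `enqW` on slot `i` comes
before `enqW` on a smaller slot, and both come before a swap that finds a value, then the value in
slot `i` has been removed before this swap.  (So, at every successful dequeue, the values present
in the array were written in the order of their slots.) -/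
def WritesOrdered {T V : Type*} (τ : Trace T V) : Prop :=
  ∀ (p q r : ℕ) (t t' u : T) (i i' j : ℕ) (v v' x : V), p < q → q < r → i' < i →
    τ[p]? = some (t, Label.enqW i v) → τ[q]? = some (t', Label.enqW i' v') →
    τ[r]? = some (u, Label.deqSwap j (some x)) →
    ∃ m w y, p < m ∧ m < r ∧ τ[m]? = some (w, Label.deqSwap i (some y))

/-- In the list `L`, `t` occurs before `u`. -/
def Precedes {T : Type*} (L : List T) (t u : T) : Prop :=
  ∃ (k m : ℕ), k < m ∧ L[k]? = some t ∧ L[m]? = some u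

end HerlihyWing

/-!
Rank the enqueues by the time at which their value is removed, those whose value is never removed
coming last in the order of their slots. Linearize a dequeue at its successful swap, and an enqueue
at the latest reservation among the enqueues of at most its rank. A scan that finds slot `i` empty
after the write to `i` shows that the value written there has already been removed. This applies to
the scan that removes a value whose enqueue started after the write to `i`, because that scan has
read a `range` that reaches the later slot. Hence every latest reservation as above comes before the
return of the enqueue that is linearized there, and the order of the positions is first-in
first-out.

In a trace of the quotient expression a successful scan is uninterrupted, so that all writes before
its swap precede the entire scan; as they are ordered by slot, the writes and the successful swaps
are already in first-in first-out order.

For the dependence on the future, let a dequeue pass slot `0` before `a` is written to slot `0` and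
`b` to slot `1`. It may continue and find `b`, while `a` is never removed; or it may be overtaken by
two complete dequeues, the first of `a` and the second of `b`.
-/

namespace HerlihyWing

variable {T V : Type*}

/-- Labels of the steps of a dequeue that has not yet found a value. -/
def Label.IsSearch : Label V → Prop
  | .deqRead _ => True
  | .deqSwap _ none => True
  | .deqRestart => True
  | _ => False

/-- The steps of thread `t` in the trace `τ`, with their positions. -/
def stepsOf (τ : Trace T V) (t : T) : Set (ℕ × Label V) :=
  {x | τ[x.1]? = some (t, x.2)}

/-- What the local state of a thread says about the set `S` of the steps it has performed so far. -/
def LocalState.Hist (S : Set (ℕ × Label V)) : LocalState V → Prop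
  | .enqStart _ => S = ∅
  | .enqReserved v i => ∃ p, S = {(p, .enqI v i)}
  | .enqWritten => ∃ v i p q, p < q ∧ S = {(p, .enqI v i), (q, .enqW i v)}
  | .deqHead => ∀ x ∈ S, x.2.IsSearch
  | .deqScan r j => (∀ x ∈ S, x.2.IsSearch) ∧
      ∃ p, (p, .deqRead r) ∈ S ∧ ∀ i < j, ∃ k > p, (k, .deqSwap i none) ∈ S
  | .deqFound v => ∃ j q, (q, .deqSwap j (some v)) ∈ S ∧
      ∀ x ∈ S, x = (q, .deqSwap j (some v)) ∨ x.2.IsSearch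
  | .finished =>
      (∃ v i p q r, p < q ∧ q < r ∧ S = {(p, .enqI v i), (q, .enqW i v), (r, .enqRet)}) ∨
      (∃ v j q r, q < r ∧ (q, .deqSwap j (some v)) ∈ S ∧ (r, .deqRet v) ∈ S ∧
        ∀ x ∈ S, x = (q, .deqSwap j (some v)) ∨ x = (r, .deqRet v) ∨ x.2.IsSearch)

theorem stepsOf_take_succ_self {τ : Trace T V} {t : T} {n : ℕ} {a : Label V}
    (hn : τ[n]? = some (t, a)) :
    stepsOf (τ.take (n + 1)) t = insert (n, a) (stepsOf (τ.take n) t) := by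
  ext ⟨k, b⟩
  simp only [stepsOf, List.getElem?_take, Set.mem_ofPred_eq, Set.mem_insert_iff, Prod.mk.injEq]
  grind

theorem stepsOf_take_succ_of_ne {τ : Trace T V} {t u : T} {n : ℕ} {a : Label V}
    (hn : τ[n]? = some (u, a)) (hne : t ≠ u) :
    stepsOf (τ.take (n + 1)) t = stepsOf (τ.take n) t := by
  ext ⟨k, b⟩
  simp only [stepsOf, List.getElem?_take, Set.mem_ofPred_eq]
  grind

theorem ThreadStep.hist_insert {g : LoopGuard} {S : Set (ℕ × Label V)} {n : ℕ} {a : Label V}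
    {l l' : LocalState V} {s s' : Shared V} (hs : ThreadStep g l s a l' s')
    (h_lt : ∀ x ∈ S, x.1 < n) (h : l.Hist S) : l'.Hist (insert (n, a) S) := by
  cases hs <;> simp only [LocalState.Hist] at h ⊢
  case enqI => exact ⟨n, by simp [h]⟩
  case enqW v i =>
    obtain ⟨p, rfl⟩ := h
    exact ⟨v, i, p, n, h_lt (p, .enqI v i) rfl, Set.pair_comm _ _⟩
  case enqRet =>
    obtain ⟨v, i, p, q, hpq, rfl⟩ := h
    exact .inl ⟨v, i, p, q, n, hpq, h_lt (q, .enqW i v) (by simp), by grind⟩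
  all_goals simp only [Set.forall_mem_insert]
  case deqRead => exact ⟨⟨trivial, h⟩, n, by simp, by simp⟩
  case deqSwapNull r j hj h_none =>
    obtain ⟨h_search, p, hp, h_scan⟩ := h
    refine ⟨⟨trivial, h_search⟩, p, .inr hp, fun i hi => ?_⟩
    obtain h_lt_j | rfl := Nat.lt_succ_iff_lt_or_eq.1 hi
    · grind
    · exact ⟨n, h_lt _ hp, by simp⟩
  case deqSwapVal => exact ⟨_, n, by simp, .inl rfl, fun x hx => .inr (h.1 x hx)⟩
  case deqRestart => exact ⟨trivial, h.1⟩
  case deqRet v =>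
    obtain ⟨j, q, hq, h_steps⟩ := h
    exact .inr ⟨v, j, q, n, h_lt _ hq, .inr hq, .inl rfl, by grind⟩

section Runs

variable [DecidableEq T]

/-- The step relation of the queue on configurations. -/
def Config.Step (g : LoopGuard) (env : Env T V) (c : Config T V) (t : T) (a : Label V)
    (c' : Config T V) : Prop :=
  ∃ l l' s', c.current env t = some l ∧ ThreadStep g l c.shared a l' s' ∧
    c' = ⟨s', Function.update c.loc t (some l')⟩

/-- `cfg` lists the configurations of a complete execution with trace `τ`: `cfg n` is the
configuration before step `n`.  Only the values of `cfg` up to `τ.length` are meaningful. -/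
structure IsRun (g : LoopGuard) (env : Env T V) (τ : Trace T V) (cfg : ℕ → Config T V) : Prop where
  start : cfg 0 = Config.init T V
  step : ∀ {n t a}, τ[n]? = some (t, a) → (cfg n).Step g env t a (cfg (n + 1))
  final : (cfg τ.length).Final

theorem Exec.exists_configs {g : LoopGuard} {env : Env T V} {c c' : Config T V} {τ : Trace T V}
    (h : Exec g env c τ c') :
    ∃ cfg : ℕ → Config T V, cfg 0 = c ∧ cfg τ.length = c' ∧
      ∀ {n t a}, τ[n]? = some (t, a) → (cfg n).Step g env t a (cfg (n + 1)) := by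
  induction h with
  | nil c => exact ⟨fun _ => c, rfl, rfl, by simp⟩
  | @cons c c' t a l l' s' τ hl hs _ ih =>
    obtain ⟨cfg, h_zero, h_length, h_step⟩ := ih
    refine ⟨fun | 0 => c | n + 1 => cfg n, rfl, h_length, fun {n u b} hn => ?_⟩
    cases n with
    | zero =>
      obtain ⟨rfl, rfl⟩ : t = u ∧ a = b := by simpa using hn
      exact ⟨l, l', s', hl, hs, h_zero⟩
    | succ n => exact h_step hn

theorem exists_isRun {g : LoopGuard} {τ : Trace T V} (hτ : τ ∈ traces T V g) :
    ∃ env cfg, IsRun g env τ cfg := by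
  obtain ⟨env, -, c, h_exec, h_final⟩ := hτ
  obtain ⟨cfg, h_zero, h_length, h_step⟩ := h_exec.exists_configs
  exact ⟨env, cfg, h_zero, h_step, h_length ▸ h_final⟩

namespace IsRun

variable {g : LoopGuard} {env : Env T V} {τ : Trace T V} {cfg : ℕ → Config T V}

theorem exists_step (R : IsRun g env τ cfg) {n : ℕ} (hn : n + 1 ≤ τ.length) :
    ∃ t a, τ[n]? = some (t, a) ∧ (cfg n).Step g env t a (cfg (n + 1)) :=
  ⟨_, _, List.getElem?_eq_getElem hn, R.step (List.getElem?_eq_getElem hn)⟩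

theorem hist (R : IsRun g env τ cfg) {n : ℕ} (hn : n ≤ τ.length) {t : T} {l : LocalState V}
    (hl : (cfg n).current env t = some l) : l.Hist (stepsOf (τ.take n) t) := by
  induction n generalizing t l with
  | zero =>
    obtain ⟨c, -, rfl⟩ : ∃ c, env t = some c ∧ c.entry = l := by
      simpa [R.start, Config.current, Config.init] using hl
    cases c <;> simp [Call.entry, LocalState.Hist, stepsOf]
  | succ n ih =>
    obtain ⟨u, a, h_label, l₀, l', s', hl₀, hs, h_cfg⟩ := R.exists_step hn
    obtain rfl | hne := eq_or_ne t u
    · obtain rfl : l' = l := by simpa [h_cfg, Config.current] using hl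
      rw [stepsOf_take_succ_self h_label]
      exact hs.hist_insert (by simp +contextual [stepsOf, List.getElem?_take]) (ih (by lia) hl₀)
    · have h_same : (cfg (n + 1)).current env t = (cfg n).current env t := by
        simp [h_cfg, Config.current, hne]
      rw [stepsOf_take_succ_of_ne h_label hne]
      exact ih (by lia) (h_same ▸ hl)

theorem loc_ne_none (R : IsRun g env τ cfg) {n k : ℕ} (hn : n ≤ τ.length) (hk : k < n) {t : T}
    {a : Label V} (h : τ[k]? = some (t, a)) : (cfg n).loc t ≠ none := by
  induction n with
  | zero => lia
  | succ n ih =>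
    obtain ⟨u, b, h_label, _, l', s', -, -, h_cfg⟩ := R.exists_step hn
    rw [h_cfg]
    grind

theorem hist_finished (R : IsRun g env τ cfg) {k : ℕ} {t : T} {a : Label V}
    (h : τ[k]? = some (t, a)) : LocalState.finished.Hist (stepsOf τ t) := by
  have hk : k < τ.length := (List.getElem?_eq_some_iff.1 h).1
  obtain ⟨l, hl⟩ := Option.ne_none_iff_exists'.1 (R.loc_ne_none le_rfl hk h)
  obtain rfl := R.final t l hl
  simpa using R.hist le_rfl (l := .finished) (by simp [Config.current, hl])

theorem lt_back_iff (R : IsRun g env τ cfg) {n : ℕ} (hn : n ≤ τ.length) {i : ℕ} :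
    i < (cfg n).shared.back ↔ ∃ p < n, ∃ t v, τ[p]? = some (t, .enqI v i) := by
  induction n with
  | zero => simp [R.start, Config.init, Shared.init]
  | succ n ih =>
    obtain ⟨u, a, h_label, l₀, l', s', hl₀, hs, h_cfg⟩ := R.exists_step hn
    rw [Nat.exists_lt_succ_right, ← ih (by lia), h_label, h_cfg]
    cases hs <;> grind

theorem exists_write_of_items_eq_some (R : IsRun g env τ cfg) {n i : ℕ} {v : V}
    (hn : n ≤ τ.length) (h : (cfg n).shared.items i = some v) :
    ∃ q < n, ∃ t, τ[q]? = some (t, .enqW i v) ∧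
      ∀ k, q < k → k < n → ∀ u x, τ[k]? ≠ some (u, .deqSwap i (some x)) := by
  induction n with
  | zero => simp [R.start, Config.init, Shared.init] at h
  | succ n ih =>
    obtain ⟨u, a, h_label, l₀, l', s', hl₀, hs, h_cfg⟩ := R.exists_step hn
    rw [h_cfg] at h
    cases hs <;> grind

theorem exists_swap_of_items_eq_none (R : IsRun g env τ cfg) {n i q : ℕ} {t : T} {v : V}
    (hn : n ≤ τ.length) (h : (cfg n).shared.items i = none) (hq : q < n)
    (h_write : τ[q]? = some (t, .enqW i v)) :
    ∃ k, q < k ∧ k < n ∧ ∃ u x, τ[k]? = some (u, .deqSwap i (some x)) := by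
  induction n with
  | zero => lia
  | succ n ih =>
    obtain ⟨u, a, h_label, l₀, l', s', hl₀, hs, h_cfg⟩ := R.exists_step hn
    rw [h_cfg] at h
    cases hs <;> grind

theorem back_eq_of_enqI (R : IsRun g env τ cfg) {n i : ℕ} {t : T} {v : V}
    (h : τ[n]? = some (t, .enqI v i)) : (cfg n).shared.back = i := by
  obtain ⟨l, l', s', hl, hs, -⟩ := R.step h
  cases hs
  rfl

theorem items_eq_of_deqSwap (R : IsRun g env τ cfg) {n j : ℕ} {t : T} {x : Option V}
    (h : τ[n]? = some (t, .deqSwap j x)) : (cfg n).shared.items j = x := by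
  obtain ⟨l, l', s', hl, hs, -⟩ := R.step h
  cases hs <;> assumption

theorem lt_back_of_deqRead (R : IsRun g env τ cfg) {n r : ℕ} {t : T}
    (h : τ[n]? = some (t, .deqRead r)) : r < (cfg n).shared.back := by
  obtain ⟨l, l', s', hl, hs, -⟩ := R.step h
  cases hs
  assumption

theorem exists_deqRead_of_deqSwap (R : IsRun g env τ cfg) {n j : ℕ} {t : T} {x : Option V}
    (h : τ[n]? = some (t, .deqSwap j x)) :
    ∃ p r, j ≤ r ∧ τ[p]? = some (t, .deqRead r) ∧
      ∀ i < j, ∃ k, p < k ∧ k < n ∧ τ[k]? = some (t, .deqSwap i none) := by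
  obtain ⟨l, l', s', hl, hs, -⟩ := R.step h
  obtain ⟨r, rfl, hj⟩ : ∃ r, l = .deqScan r j ∧ g.Holds j r := by
    cases hs <;> exact ⟨_, rfl, ‹_›⟩
  obtain ⟨-, p, hp, h_scan⟩ := R.hist (List.getElem?_eq_some_iff.1 h).1.le hl
  have h_le : j ≤ r := by cases g <;> grind [LoopGuard.Holds]
  simp only [stepsOf, List.getElem?_take, Set.mem_ofPred_eq] at hp h_scan
  exact ⟨p, r, h_le, by grind, fun i hi => by grind⟩

end IsRun

end Runs

/-- A completed enqueue of a trace, with the positions `reserve`, `write` and `ret` of its steps. -/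
structure Enqueue (τ : Trace T V) where
  thread : T
  value : V
  slot : ℕ
  reserve : ℕ
  write : ℕ
  ret : ℕ
  reserve_lt_write : reserve < write
  write_lt_ret : write < ret
  steps_eq : stepsOf τ thread =
    {(reserve, .enqI value slot), (write, .enqW slot value), (ret, .enqRet)}

/-- A completed dequeue of a trace, with the positions `swap` of the swap that finds a value and
`ret` of the return. -/
structure Dequeue (τ : Trace T V) where
  thread : T
  value : V
  slot : ℕ
  swap : ℕ
  ret : ℕ
  swap_lt_ret : swap < ret
  swap_mem : (swap, .deqSwap slot (some value)) ∈ stepsOf τ thread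
  ret_mem : (ret, .deqRet value) ∈ stepsOf τ thread
  of_mem : ∀ x ∈ stepsOf τ thread,
    x = (swap, .deqSwap slot (some value)) ∨ x = (ret, .deqRet value) ∨ x.2.IsSearch

variable {τ : Trace T V}

namespace Enqueue

theorem getElem?_reserve (e : Enqueue τ) :
    τ[e.reserve]? = some (e.thread, .enqI e.value e.slot) := by
  have h : (e.reserve, .enqI e.value e.slot) ∈ stepsOf τ e.thread := by simp [e.steps_eq]
  exact h

theorem getElem?_write (e : Enqueue τ) : τ[e.write]? = some (e.thread, .enqW e.slot e.value) := by
  have h : (e.write, .enqW e.slot e.value) ∈ stepsOf τ e.thread := by simp [e.steps_eq]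
  exact h

theorem getElem?_ret (e : Enqueue τ) : τ[e.ret]? = some (e.thread, .enqRet) := by
  have h : (e.ret, .enqRet) ∈ stepsOf τ e.thread := by simp [e.steps_eq]
  exact h

theorem eq_of_getElem? (e : Enqueue τ) {k : ℕ} {a : Label V} (h : τ[k]? = some (e.thread, a)) :
    k = e.reserve ∧ a = .enqI e.value e.slot ∨ k = e.write ∧ a = .enqW e.slot e.value ∨
      k = e.ret ∧ a = .enqRet := by
  have h_mem : (k, a) ∈ stepsOf τ e.thread := h
  simpa [e.steps_eq] using h_mem

theorem eq_of_thread_eq {e e' : Enqueue τ} (h : e.thread = e'.thread) : e = e' := by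
  have h_reserve := e'.eq_of_getElem? (h ▸ e.getElem?_reserve)
  have h_write := e'.eq_of_getElem? (h ▸ e.getElem?_write)
  have h_ret := e'.eq_of_getElem? (h ▸ e.getElem?_ret)
  cases e
  cases e'
  simp_all

theorem eq_of_reserve_eq {e e' : Enqueue τ} (h : e.reserve = e'.reserve) : e = e' :=
  eq_of_thread_eq (by grind [e.getElem?_reserve, e'.getElem?_reserve])

end Enqueue

namespace Dequeue

theorem getElem?_swap (d : Dequeue τ) :
    τ[d.swap]? = some (d.thread, .deqSwap d.slot (some d.value)) :=
  d.swap_mem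

theorem getElem?_ret (d : Dequeue τ) : τ[d.ret]? = some (d.thread, .deqRet d.value) :=
  d.ret_mem

theorem eq_of_getElem? (d : Dequeue τ) {k : ℕ} {a : Label V} (h : τ[k]? = some (d.thread, a)) :
    k = d.swap ∧ a = .deqSwap d.slot (some d.value) ∨ k = d.ret ∧ a = .deqRet d.value ∨
      a.IsSearch := by
  simpa using d.of_mem (k, a) h

theorem eq_of_thread_eq {d d' : Dequeue τ} (h : d.thread = d'.thread) : d = d' := by
  have h_swap := d'.eq_of_getElem? (h ▸ d.getElem?_swap)
  have h_ret := d'.eq_of_getElem? (h ▸ d.getElem?_ret)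
  cases d
  cases d'
  simp_all [Label.IsSearch]

theorem eq_of_swap_eq {d d' : Dequeue τ} (h : d.swap = d'.swap) : d = d' :=
  eq_of_thread_eq (by grind [d.getElem?_swap, d'.getElem?_swap])

theorem thread_ne (d : Dequeue τ) (e : Enqueue τ) : d.thread ≠ e.thread := fun h => by
  have h_swap := d.getElem?_swap
  rw [h] at h_swap
  simpa using e.eq_of_getElem? h_swap

end Dequeue

/-- The completed operations of a trace. -/
abbrev Operation (τ : Trace T V) := Enqueue τ ⊕ Dequeue τ

namespace Operation

/-- The thread that performs an operation. -/
def thread : Operation τ → T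
  | .inl e => e.thread
  | .inr d => d.thread

/-- The symbol of an operation in the sequential history. -/
def op : Operation τ → Op V
  | .inl e => .enq e.value
  | .inr d => .deq d.value

/-- The position at which an operation returns. -/
def ret : Operation τ → ℕ
  | .inl e => e.ret
  | .inr d => d.ret

/-- The position at which an operation changes the array: the write of an enqueue, the successful
swap of a dequeue. -/
def effect : Operation τ → ℕ
  | .inl e => e.write
  | .inr d => d.swap

theorem thread_injective : Function.Injective (thread : Operation τ → T) := by
  rintro (e | d) (e' | d') h
  · exact congrArg _ (Enqueue.eq_of_thread_eq h)
  · exact absurd h.symm (d'.thread_ne e)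
  · exact absurd h (d.thread_ne e')
  · exact congrArg _ (Dequeue.eq_of_thread_eq h)

theorem exists_getElem?_effect (o : Operation τ) : ∃ a, τ[o.effect]? = some (o.thread, a) :=
  match o with
  | .inl e => ⟨_, e.getElem?_write⟩
  | .inr d => ⟨_, d.getElem?_swap⟩

theorem effect_lt_ret (o : Operation τ) : o.effect < o.ret :=
  match o with
  | .inl e => e.write_lt_ret
  | .inr d => d.swap_lt_ret

theorem exists_getElem?_ret (o : Operation τ) :
    ∃ a, τ[o.ret]? = some (o.thread, a) ∧ a.IsReturn :=
  match o with
  | .inl e => ⟨_, e.getElem?_ret, trivial⟩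
  | .inr d => ⟨_, d.getElem?_ret, trivial⟩

theorem effect_injective : Function.Injective (effect : Operation τ → ℕ) := fun o o' h => by
  obtain ⟨a, ha⟩ := o.exists_getElem?_effect
  obtain ⟨a', ha'⟩ := o'.exists_getElem?_effect
  exact thread_injective (by grind)

instance : Finite (Operation τ) :=
  have h_lt (o : Operation τ) : o.effect < τ.length :=
    (List.getElem?_eq_some_iff.1 o.exists_getElem?_effect.choose_spec).1
  Finite.of_injective (fun o => (⟨o.effect, h_lt o⟩ : Fin τ.length))
    fun _ _ h => effect_injective (congrArg Fin.val h)

theorem eq_op_of_opOf {o : Operation τ} {x : Op V} (h : OpOf τ o.thread x) : x = o.op := by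
  cases x <;> simp only [OpOf, List.mem_iff_getElem?] at h <;> cases o
  case enq.inl v e =>
    obtain ⟨i, k, hk⟩ := h
    grind [op, e.eq_of_getElem? hk]
  case enq.inr v d =>
    obtain ⟨i, k, hk⟩ := h
    simpa [Label.IsSearch] using d.eq_of_getElem? hk
  case deq.inl v e =>
    obtain ⟨k, hk⟩ := h
    simpa using e.eq_of_getElem? hk
  case deq.inr v d =>
    obtain ⟨k, hk⟩ := h
    grind [op, Label.IsSearch, d.eq_of_getElem? hk]

theorem opOf_iff {o : Operation τ} {x : Op V} : OpOf τ o.thread x ↔ x = o.op := by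
  refine ⟨eq_op_of_opOf, ?_⟩
  rintro rfl
  cases o with
  | inl e => exact ⟨_, List.mem_of_getElem? e.getElem?_reserve⟩
  | inr d => exact List.mem_of_getElem? d.getElem?_ret

end Operation

section Traces

variable [DecidableEq T] {g : LoopGuard}

theorem exists_operation (hτ : τ ∈ traces T V g) {t : T} {a : Label V} (h : (t, a) ∈ τ) :
    ∃ o : Operation τ, o.thread = t := by
  obtain ⟨env, cfg, R⟩ := exists_isRun hτ
  obtain ⟨k, hk⟩ := List.mem_iff_getElem?.1 h
  obtain ⟨v, i, p, q, r, hpq, hqr, h_steps⟩ | ⟨v, j, q, r, hqr, hq, hr, h_steps⟩ :=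
    R.hist_finished hk
  · exact ⟨.inl ⟨t, v, i, p, q, r, hpq, hqr, h_steps⟩, rfl⟩
  · exact ⟨.inr ⟨t, v, j, q, r, hqr, hq, hr, h_steps⟩, rfl⟩

theorem exists_enqueue_of_enqI (hτ : τ ∈ traces T V g) {k i : ℕ} {t : T} {v : V}
    (h : τ[k]? = some (t, .enqI v i)) :
    ∃ e : Enqueue τ, e.thread = t ∧ e.value = v ∧ e.slot = i ∧ e.reserve = k := by
  obtain ⟨e | d, rfl⟩ := exists_operation hτ (List.mem_of_getElem? h)
  · exact ⟨e, by simpa [Operation.thread, and_comm, and_left_comm, eq_comm] using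
      e.eq_of_getElem? h⟩
  · simpa [Label.IsSearch] using d.eq_of_getElem? h

theorem exists_enqueue_of_enqW (hτ : τ ∈ traces T V g) {k i : ℕ} {t : T} {v : V}
    (h : τ[k]? = some (t, .enqW i v)) :
    ∃ e : Enqueue τ, e.thread = t ∧ e.value = v ∧ e.slot = i ∧ e.write = k := by
  obtain ⟨e | d, rfl⟩ := exists_operation hτ (List.mem_of_getElem? h)
  · exact ⟨e, by simpa [Operation.thread, and_comm, and_left_comm, eq_comm] using
      e.eq_of_getElem? h⟩
  · simpa [Label.IsSearch] using d.eq_of_getElem? h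

theorem exists_dequeue_of_deqSwap (hτ : τ ∈ traces T V g) {k j : ℕ} {t : T} {v : V}
    (h : τ[k]? = some (t, .deqSwap j (some v))) :
    ∃ d : Dequeue τ, d.thread = t ∧ d.value = v ∧ d.slot = j ∧ d.swap = k := by
  obtain ⟨e | d, rfl⟩ := exists_operation hτ (List.mem_of_getElem? h)
  · simpa using e.eq_of_getElem? h
  · exact ⟨d, by simpa [Operation.thread, Label.IsSearch, and_comm, and_left_comm, eq_comm]
      using d.eq_of_getElem? h⟩

theorem Enqueue.slot_lt_slot (hτ : τ ∈ traces T V g) {e e' : Enqueue τ}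
    (h : e.reserve < e'.reserve) : e.slot < e'.slot := by
  obtain ⟨env, cfg, R⟩ := exists_isRun hτ
  have h_le : e'.reserve ≤ τ.length := (List.getElem?_eq_some_iff.1 e'.getElem?_reserve).1.le
  rw [← R.back_eq_of_enqI e'.getElem?_reserve]
  exact (R.lt_back_iff h_le).2 ⟨_, h, _, _, e.getElem?_reserve⟩

theorem Enqueue.eq_of_slot_eq (hτ : τ ∈ traces T V g) {e e' : Enqueue τ}
    (h : e.slot = e'.slot) : e = e' := by
  obtain h_lt | h_eq | h_lt := lt_trichotomy e.reserve e'.reserve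
  · exact absurd h (slot_lt_slot hτ h_lt).ne
  · exact eq_of_reserve_eq h_eq
  · exact absurd h (slot_lt_slot hτ h_lt).ne'

theorem Dequeue.exists_enqueue (hτ : τ ∈ traces T V g) (d : Dequeue τ) :
    ∃ e : Enqueue τ, e.slot = d.slot ∧ e.value = d.value ∧ e.write < d.swap ∧
      ∀ d' : Dequeue τ, d'.slot = d.slot → e.write < d'.swap → d.swap ≤ d'.swap := by
  obtain ⟨env, cfg, R⟩ := exists_isRun hτ
  have h_le : d.swap ≤ τ.length := (List.getElem?_eq_some_iff.1 d.getElem?_swap).1.le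
  obtain ⟨q, hq, t, h_write, h_unswapped⟩ :=
    R.exists_write_of_items_eq_some h_le (R.items_eq_of_deqSwap d.getElem?_swap)
  obtain ⟨e, rfl, h_value, h_slot, rfl⟩ := exists_enqueue_of_enqW hτ h_write
  refine ⟨e, h_slot, h_value, hq, fun d' h_slot' h_lt => ?_⟩
  by_contra! h_lt'
  exact h_unswapped d'.swap h_lt h_lt' d'.thread d'.value (h_slot' ▸ d'.getElem?_swap)

theorem write_lt_swap (hτ : τ ∈ traces T V g) {e : Enqueue τ} {d : Dequeue τ}
    (h : e.slot = d.slot) : e.write < d.swap := by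
  obtain ⟨e', h_slot, -, h_lt, -⟩ := d.exists_enqueue hτ
  rwa [Enqueue.eq_of_slot_eq hτ (h.trans h_slot.symm)]

theorem Dequeue.eq_of_slot_eq (hτ : τ ∈ traces T V g) {d d' : Dequeue τ}
    (h : d.slot = d'.slot) : d = d' := by
  obtain ⟨e, h_slot, -, -, h_first⟩ := d.exists_enqueue hτ
  obtain ⟨e', h_slot', -, -, h_first'⟩ := d'.exists_enqueue hτ
  exact eq_of_swap_eq <| le_antisymm
    (h_first d' h.symm (write_lt_swap hτ (h_slot.trans h)))
    (h_first' d h (write_lt_swap hτ (h_slot'.trans h.symm)))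

theorem exists_dequeue_of_null_swap (hτ : τ ∈ traces T V g) {e : Enqueue τ} {k : ℕ} {t : T}
    (h_lt : e.write < k) (h : τ[k]? = some (t, .deqSwap e.slot none)) :
    ∃ d : Dequeue τ, d.slot = e.slot ∧ d.swap < k := by
  obtain ⟨env, cfg, R⟩ := exists_isRun hτ
  obtain ⟨m, -, hm, u, x, h_swap⟩ := R.exists_swap_of_items_eq_none
    (List.getElem?_eq_some_iff.1 h).1.le (R.items_eq_of_deqSwap h) h_lt e.getElem?_write
  obtain ⟨d, -, -, h_slot, rfl⟩ := exists_dequeue_of_deqSwap hτ h_swap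
  exact ⟨d, h_slot, hm⟩

/-- The `range` of the scan that removes `e` was read after `e` had reserved its slot. -/
theorem exists_null_swap_between (hτ : τ ∈ traces T V g) {e : Enqueue τ} {d : Dequeue τ}
    (h : e.slot = d.slot) {i : ℕ} (hi : i < d.slot) :
    ∃ k, e.reserve < k ∧ k < d.swap ∧ τ[k]? = some (d.thread, .deqSwap i none) := by
  obtain ⟨env, cfg, R⟩ := exists_isRun hτ
  obtain ⟨p, r, h_le, h_read, h_scan⟩ := R.exists_deqRead_of_deqSwap d.getElem?_swap
  obtain ⟨m, hm, t, v, h_reserve⟩ := (R.lt_back_iff (List.getElem?_eq_some_iff.1 h_read).1.le).1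
    (h_le.trans_lt (R.lt_back_of_deqRead h_read))
  obtain ⟨e', -, -, h_slot, rfl⟩ := exists_enqueue_of_enqI hτ h_reserve
  obtain rfl := Enqueue.eq_of_slot_eq hτ (h_slot.trans h.symm)
  obtain ⟨k, hpk, hk, h_null⟩ := h_scan i hi
  exact ⟨k, hm.trans hpk, hk, h_null⟩

theorem exists_dequeue_before (hτ : τ ∈ traces T V g) {e e' : Enqueue τ} {d : Dequeue τ}
    (h_slot : e'.slot = d.slot) (h_write : e.write < e'.reserve) :
    ∃ d' : Dequeue τ, d'.slot = e.slot ∧ d'.swap < d.swap := by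
  have h_lt : e.slot < d.slot :=
    h_slot ▸ Enqueue.slot_lt_slot hτ (e.reserve_lt_write.trans h_write)
  obtain ⟨k, h_after, h_before, h_null⟩ := exists_null_swap_between hτ h_slot h_lt
  obtain ⟨d', h_slot', h_swap⟩ := exists_dequeue_of_null_swap hτ (h_write.trans h_after) h_null
  exact ⟨d', h_slot', h_swap.trans h_before⟩

end Traces

section Linearization

theorem exists_list_pairwise_lt {α K : Type*} [Finite α] [LinearOrder K] {key : α → K}
    (h_inj : Function.Injective key) :
    ∃ l : List α, (∀ a, a ∈ l) ∧ l.Pairwise (key · < key ·) := by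
  have := Fintype.ofFinite α
  let _ : LinearOrder α := LinearOrder.lift' key h_inj
  exact ⟨Finset.univ.sort, by simp, (Finset.sortedLT_sort Finset.univ).pairwise⟩

section Queue

variable {E D K : Type*} [Preorder K] {key : E ⊕ D → K} {source : D → E}

theorem exists_eq_source_cons
    (h_lt : ∀ d, key (.inl (source d)) < key (.inr d))
    (h_fifo : ∀ e d, key (.inl e) < key (.inl (source d)) →
      ∃ d', source d' = e ∧ key (.inr d') < key (.inr d))
    {q : List E} {l : List (E ⊕ D)} {d : D}
    (h_sorted : (q.map Sum.inl ++ Sum.inr d :: l).Pairwise (key · < key ·))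
    (h_mem : ∀ d', .inr d' ∈ Sum.inr d :: l ↔
      .inl (source d') ∈ q.map Sum.inl ++ Sum.inr d :: l) :
    ∃ q', q = source d :: q' := by
  obtain ⟨h_sorted_q, h_sorted_l, -⟩ := List.pairwise_append.1 h_sorted
  have h_after := (List.pairwise_cons.1 h_sorted_l).1
  have h_source_mem : source d ∈ q := by
    have h := (h_mem d).1 List.mem_cons_self
    simp only [List.mem_append, List.mem_map, Sum.inl.injEq, exists_eq_right,
      List.mem_cons, reduceCtorEq, false_or] at h
    exact h.resolve_right fun h => lt_asymm (h_lt d) (h_after _ h)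
  obtain ⟨e, q, rfl⟩ := List.exists_cons_of_ne_nil (List.ne_nil_of_mem h_source_mem)
  suffices e = source d from ⟨q, by rw [this]⟩
  by_contra h_ne
  have h_source_mem_tail : source d ∈ q := by grind
  have h_before : key (.inl e) < key (.inl (source d)) :=
    (List.pairwise_cons.1 h_sorted_q).1 _ (List.mem_map_of_mem h_source_mem_tail)
  obtain ⟨d', rfl, h_removed⟩ := h_fifo e d h_before
  obtain h_eq | h_mem' := List.mem_cons.1 ((h_mem d').2 (by simp))
  · exact h_ne (congrArg source (Sum.inr_injective h_eq))
  · exact lt_asymm h_removed (h_after _ h_mem')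

theorem queueRun_of_pairwise
    (h_lt : ∀ d, key (.inl (source d)) < key (.inr d))
    (h_fifo : ∀ e d, key (.inl e) < key (.inl (source d)) →
      ∃ d', source d' = e ∧ key (.inr d') < key (.inr d))
    (value : E → V) (h_source : Function.Injective source)
    {q : List E} {l : List (E ⊕ D)} (h_sorted : (q.map Sum.inl ++ l).Pairwise (key · < key ·))
    (h_mem : ∀ d, .inr d ∈ l ↔ .inl (source d) ∈ q.map Sum.inl ++ l) :
    QueueRun (q.map value) (l.map (Sum.elim (.enq ∘ value) (.deq ∘ value ∘ source))) := by
  induction l generalizing q with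
  | nil => trivial
  | cons o l ih =>
    cases o with
    | inl e =>
      have h_run := ih (q := q ++ [e]) (by simpa using h_sorted) (by simpa using h_mem)
      simpa [QueueRun] using h_run
    | inr d =>
      obtain ⟨q, rfl⟩ := exists_eq_source_cons h_lt h_fifo h_sorted h_mem
      have h_sorted_rest : (q.map Sum.inl ++ l).Pairwise (key · < key ·) :=
        h_sorted.sublist (by simp)
      have h_after : ∀ x ∈ l, key (.inr d) < key x :=
        (List.pairwise_cons.1 (List.pairwise_append.1 h_sorted).2.1).1
      have h_front : ∀ x ∈ q.map Sum.inl ++ .inr d :: l, key (.inl (source d)) < key x :=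
        (List.pairwise_cons.1 h_sorted).1
      have h_not_mem : .inr d ∉ l ∧ .inl (source d) ∉ q.map Sum.inl ++ l :=
        ⟨fun h => lt_irrefl _ (h_after _ h),
          fun h => lt_irrefl _ (h_front _ (((List.sublist_cons_self _ _).append_left _).subset h))⟩
      refine ⟨q.map value, rfl, ih h_sorted_rest fun d' => ?_⟩
      obtain rfl | h_ne := eq_or_ne d' d
      · simp only [h_not_mem]
      · simpa [h_ne, h_source.ne h_ne] using h_mem d'

end Queue

theorem queueRun_map_op [DecidableEq T] {g : LoopGuard} (hτ : τ ∈ traces T V g) {K : Type*}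
    [Preorder K] {key : Operation τ → K}
    (h_lt : ∀ {e d}, e.slot = d.slot → key (.inl e) < key (.inr d))
    (h_fifo : ∀ {e e' d}, e'.slot = d.slot → key (.inl e) < key (.inl e') →
      ∃ d', d'.slot = e.slot ∧ key (.inr d') < key (.inr d))
    {l : List (Operation τ)} (h_all : ∀ o, o ∈ l) (h_sorted : l.Pairwise (key · < key ·)) :
    QueueRun [] (l.map Operation.op) := by
  choose source h_slot h_value _ _ using fun d : Dequeue τ => d.exists_enqueue hτ
  have h_op : (Operation.op : Operation τ → Op V) =
      Sum.elim (.enq ∘ Enqueue.value) (.deq ∘ Enqueue.value ∘ source) := by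
    funext o
    cases o <;> simp [Operation.op, h_value]
  rw [h_op]
  refine queueRun_of_pairwise (q := []) (fun d => h_lt (h_slot d)) (fun e d h => ?_)
    Enqueue.value (fun d d' h => ?_) h_sorted (by simp [h_all])
  · obtain ⟨d', h_slot', h_before⟩ := h_fifo (h_slot d) h
    exact ⟨d', Enqueue.eq_of_slot_eq hτ ((h_slot d').trans h_slot'), h_before⟩
  · exact Dequeue.eq_of_slot_eq hτ (by rw [← h_slot, h, h_slot])

theorem exists_isLinearization [DecidableEq T] {g : LoopGuard} (hτ : τ ∈ traces T V g) {K : Type*}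
    [LinearOrder K] {key : Operation τ → K} (h_key : Function.Injective key)
    {point : Operation τ → ℕ} (h_mono : ∀ {o o'}, key o < key o' → point o ≤ point o')
    (h_start : ∀ o, ∃ k ≤ point o, ∃ a, τ[k]? = some (o.thread, a))
    (h_ret : ∀ o, point o < o.ret)
    (h_lt : ∀ {e d}, e.slot = d.slot → key (.inl e) < key (.inr d))
    (h_fifo : ∀ {e e' d}, e'.slot = d.slot → key (.inl e) < key (.inl e') →
      ∃ d', d'.slot = e.slot ∧ key (.inr d') < key (.inr d)) :
    ∃ L, IsLinearization τ (Function.extend Operation.thread point 0) L := by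
  obtain ⟨l, h_all, h_sorted⟩ := exists_list_pairwise_lt h_key
  have h_point (o : Operation τ) : Function.extend Operation.thread point 0 o.thread = point o :=
    Operation.thread_injective.extend_apply point 0 o
  refine ⟨l.map Operation.thread, ?_, fun t => ?_, ?_, ?_, ?_, l.map Operation.op, ?_, ?_⟩
  · exact (h_sorted.imp fun h => ne_of_apply_ne key h.ne).map _
      fun _ _ => Operation.thread_injective.ne
  · rw [List.mem_map]
    constructor
    · rintro ⟨o, -, rfl⟩
      obtain ⟨k, -, a, h⟩ := h_start o
      exact ⟨a, List.mem_of_getElem? h⟩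
    · rintro ⟨a, h⟩
      obtain ⟨o, rfl⟩ := exists_operation hτ h
      exact ⟨o, h_all o, rfl⟩
  · exact List.pairwise_map.2 (h_sorted.imp fun h => by simpa only [h_point] using h_mono h)
  · rintro _ ht
    obtain ⟨o, -, rfl⟩ := List.mem_map.1 ht
    obtain ⟨k, hk, a, h⟩ := h_start o
    exact ⟨k, a, by rwa [h_point], h⟩
  · rintro _ ht
    obtain ⟨o, -, rfl⟩ := List.mem_map.1 ht
    obtain ⟨a, h⟩ := o.exists_getElem?_ret
    exact ⟨o.ret, a, h_point o ▸ h_ret o, h⟩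
  · simp only [List.forall₂_map_left_iff, List.forall₂_map_right_iff, List.forall₂_same,
      Operation.opOf_iff, implies_true]
  · exact queueRun_map_op hτ h_lt h_fifo h_all h_sorted

end Linearization

section Linearizable

open Classical in
/-- The rank of an enqueue: the position of the swap that removes its value. The enqueues whose
values are never removed come after all the others, in the order of their slots. -/
noncomputable def Enqueue.rank (e : Enqueue τ) : ℕ :=
  if h : ∃ d : Dequeue τ, d.slot = e.slot then h.choose.swap else τ.length + e.slot

/-- The latest reservation among the enqueues of rank at most that of `e`, used as the linearization
point of `e`. -/
noncomputable def Enqueue.point (e : Enqueue τ) : ℕ :=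
  ⨆ e' : {e' : Enqueue τ // e'.rank ≤ e.rank}, e'.1.reserve

namespace Operation

/-- The linearization point of an operation of an arbitrary trace. -/
noncomputable def point : Operation τ → ℕ
  | .inl e => e.point
  | .inr d => d.swap

/-- The linearization point, refined by the rank, which decides between enqueues with the same
point. -/
noncomputable def key : Operation τ → ℕ ×ₗ ℕ
  | .inl e => toLex (e.point, e.rank)
  | .inr d => toLex (d.swap, 0)

theorem point_le_point_of_key_lt {o o' : Operation τ} (h : o.key < o'.key) :
    o.point ≤ o'.point := by
  obtain e | d := o <;> obtain e' | d' := o' <;>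
    exact (Prod.Lex.toLex_lt_toLex.1 h).elim le_of_lt fun h => h.1.le

end Operation

theorem Dequeue.swap_lt_length (d : Dequeue τ) : d.swap < τ.length :=
  (List.getElem?_eq_some_iff.1 d.getElem?_swap).1

namespace Enqueue

theorem exists_dequeue_of_rank_lt_length {e : Enqueue τ} (h : e.rank < τ.length) :
    ∃ d : Dequeue τ, d.slot = e.slot ∧ d.swap = e.rank := by
  by_cases h_removed : ∃ d : Dequeue τ, d.slot = e.slot
  · exact ⟨h_removed.choose, h_removed.choose_spec, by rw [rank, dif_pos h_removed]⟩
  · rw [rank, dif_neg h_removed] at h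
    lia

theorem exists_reserve_eq_point (e : Enqueue τ) :
    ∃ e' : Enqueue τ, e'.rank ≤ e.rank ∧ e'.reserve = e.point := by
  have : Finite (Enqueue τ) := Finite.of_injective (Sum.inl : _ → Operation τ) Sum.inl_injective
  have : Nonempty {e' : Enqueue τ // e'.rank ≤ e.rank} := ⟨e, le_rfl⟩
  obtain ⟨e', h⟩ :=
    exists_eq_ciSup_of_finite (f := fun e' : {e' : Enqueue τ // e'.rank ≤ e.rank} => e'.1.reserve)
  exact ⟨e'.1, e'.2, h⟩

theorem reserve_le_point {e e' : Enqueue τ} (h : e'.rank ≤ e.rank) : e'.reserve ≤ e.point := by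
  have : Finite (Enqueue τ) := Finite.of_injective (Sum.inl : _ → Operation τ) Sum.inl_injective
  exact le_ciSup (f := fun e' : {e' : Enqueue τ // e'.rank ≤ e.rank} => e'.1.reserve)
    (Set.finite_range _).bddAbove ⟨e', h⟩

theorem point_mono {e e' : Enqueue τ} (h : e.rank ≤ e'.rank) : e.point ≤ e'.point := by
  obtain ⟨f, h_rank, h_eq⟩ := e.exists_reserve_eq_point
  exact h_eq ▸ reserve_le_point (h_rank.trans h)

theorem rank_le_of_key_lt {e e' : Enqueue τ}
    (h : Operation.key (.inl e) < Operation.key (.inl e')) : e.rank ≤ e'.rank := by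
  by_contra! h_lt
  obtain h_point | ⟨-, h_rank⟩ := Prod.Lex.toLex_lt_toLex.1 h
  · exact h_point.not_ge (point_mono h_lt.le)
  · exact h_rank.not_gt h_lt

theorem point_ne_swap (e : Enqueue τ) (d : Dequeue τ) : e.point ≠ d.swap := fun h => by
  obtain ⟨e', -, h_eq⟩ := e.exists_reserve_eq_point
  have h_reserve := e'.getElem?_reserve
  rw [h_eq, h, d.getElem?_swap] at h_reserve
  simp at h_reserve

variable [DecidableEq T] {g : LoopGuard}

theorem rank_eq_swap (hτ : τ ∈ traces T V g) {e : Enqueue τ} {d : Dequeue τ}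
    (h : d.slot = e.slot) : e.rank = d.swap := by
  have h_removed : ∃ d : Dequeue τ, d.slot = e.slot := ⟨d, h⟩
  rw [rank, dif_pos h_removed, Dequeue.eq_of_slot_eq hτ (h_removed.choose_spec.trans h.symm)]

theorem rank_eq_length_add_slot (hτ : τ ∈ traces T V g) {e : Enqueue τ}
    (h : τ.length ≤ e.rank) : e.rank = τ.length + e.slot :=
  dif_neg fun ⟨d, h_slot⟩ => (rank_eq_swap hτ h_slot ▸ h).not_gt d.swap_lt_length

theorem rank_injective (hτ : τ ∈ traces T V g) :
    Function.Injective (rank : Enqueue τ → ℕ) := fun e e' h => by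
  refine eq_of_slot_eq hτ ?_
  obtain h_lt | h_le := lt_or_ge e.rank τ.length
  · obtain ⟨d, h_slot, h_rank⟩ := exists_dequeue_of_rank_lt_length h_lt
    obtain ⟨d', h_slot', h_rank'⟩ := exists_dequeue_of_rank_lt_length (h ▸ h_lt)
    rw [← h_slot, ← h_slot', Dequeue.eq_of_swap_eq (h_rank.trans (h.trans h_rank'.symm))]
  · have h_eq := rank_eq_length_add_slot hτ h_le
    have h_eq' := rank_eq_length_add_slot hτ (h ▸ h_le)
    lia

theorem rank_lt_rank (hτ : τ ∈ traces T V g) {e e' : Enqueue τ} (h : e.write < e'.reserve) :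
    e.rank < e'.rank := by
  obtain h_lt' | h_le' := lt_or_ge e'.rank τ.length
  · obtain ⟨d', h_slot', h_rank'⟩ := exists_dequeue_of_rank_lt_length h_lt'
    obtain ⟨d, h_slot, h_before⟩ := exists_dequeue_before hτ h_slot'.symm h
    rwa [rank_eq_swap hτ h_slot, ← h_rank']
  · obtain h_lt | h_le := lt_or_ge e.rank τ.length
    · exact h_lt.trans_le h_le'
    · rw [rank_eq_length_add_slot hτ h_le, rank_eq_length_add_slot hτ h_le']
      exact Nat.add_lt_add_left (slot_lt_slot hτ (e.reserve_lt_write.trans h)) _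

theorem point_lt_ret (hτ : τ ∈ traces T V g) (e : Enqueue τ) : e.point < e.ret := by
  obtain ⟨e', h_rank, h_eq⟩ := e.exists_reserve_eq_point
  by_contra! h_le
  exact h_rank.not_gt (rank_lt_rank hτ (e.write_lt_ret.trans_le (h_eq ▸ h_le)))

theorem point_lt_swap (hτ : τ ∈ traces T V g) {e : Enqueue τ} {d : Dequeue τ}
    (h : e.slot = d.slot) : e.point < d.swap := by
  obtain ⟨e', h_rank, h_eq⟩ := e.exists_reserve_eq_point
  rw [rank_eq_swap hτ h.symm] at h_rank
  obtain ⟨d', h_slot', h_swap'⟩ :=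
    exists_dequeue_of_rank_lt_length (h_rank.trans_lt d.swap_lt_length)
  calc e.point = e'.reserve := h_eq.symm
    _ < e'.write := e'.reserve_lt_write
    _ < d'.swap := write_lt_swap hτ h_slot'.symm
    _ = e'.rank := h_swap'
    _ ≤ d.swap := h_rank

end Enqueue

variable [DecidableEq T] {g : LoopGuard}

theorem Operation.key_injective (hτ : τ ∈ traces T V g) :
    Function.Injective (key : Operation τ → ℕ ×ₗ ℕ) := by
  rintro (e | d) (e' | d') h <;> obtain ⟨h_point, h_rank⟩ := Prod.ext_iff.1 (toLex_inj.1 h)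
  · exact congrArg _ (Enqueue.rank_injective hτ h_rank)
  · exact absurd h_point (e.point_ne_swap d')
  · exact absurd h_point.symm (e'.point_ne_swap d)
  · exact congrArg _ (Dequeue.eq_of_swap_eq h_point)

theorem linearizable (hτ : τ ∈ traces T V g) : Linearizable τ := by
  refine ⟨_, exists_isLinearization hτ (Operation.key_injective hτ)
    Operation.point_le_point_of_key_lt ?_ ?_ ?_ ?_⟩
  · rintro (e | d)
    · exact ⟨e.reserve, e.reserve_le_point le_rfl, _, e.getElem?_reserve⟩
    · exact ⟨d.swap, le_rfl, _, d.getElem?_swap⟩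
  · rintro (e | d)
    · exact e.point_lt_ret hτ
    · exact d.swap_lt_ret
  · exact fun h_slot => Prod.Lex.toLex_lt_toLex.2 (.inl (Enqueue.point_lt_swap hτ h_slot))
  · intro e e' d h_slot h_key
    have h_ne : e.rank ≠ e'.rank := fun h => h_key.ne (by rw [Enqueue.rank_injective hτ h])
    have h_lt : e.rank < d.swap :=
      Enqueue.rank_eq_swap hτ h_slot.symm ▸ (Enqueue.rank_le_of_key_lt h_key).lt_of_ne h_ne
    obtain ⟨d', h_slot', h_swap⟩ :=
      Enqueue.exists_dequeue_of_rank_lt_length (h_lt.trans d.swap_lt_length)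
    exact ⟨d', h_slot', Prod.Lex.toLex_lt_toLex.2 (.inl (h_swap.trans_lt h_lt))⟩

end Linearizable

section Quotient

/-- Every swap that finds a value, in slot `j`, immediately follows swaps by the same thread that
find `null` in the slots `0, …, j - 1`. -/
def SwapsContiguous (w : Trace T V) : Prop :=
  ∀ (k : ℕ) (t : T) (j : ℕ) (v : V), w[k]? = some (t, Label.deqSwap j (some v)) →
    ∃ s, k = s + j ∧ ∀ i < j, w[s + i]? = some (t, Label.deqSwap i none)

namespace SwapsContiguous

theorem append {w w' : Trace T V} (h : SwapsContiguous w) (h' : SwapsContiguous w') :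
    SwapsContiguous (w ++ w') := by
  intro k t j v hk
  obtain h_lt | h_le := lt_or_ge k w.length
  · rw [List.getElem?_append_left h_lt] at hk
    obtain ⟨s, rfl, hs⟩ := h k t j v hk
    refine ⟨s, rfl, fun i hi => ?_⟩
    rw [List.getElem?_append_left (by lia), hs i hi]
  · obtain ⟨k, rfl⟩ := Nat.exists_eq_add_of_le h_le
    rw [List.getElem?_append_right h_le, Nat.add_sub_cancel_left] at hk
    obtain ⟨s, rfl, hs⟩ := h' k t j v hk
    refine ⟨w.length + s, (Nat.add_assoc ..).symm, fun i hi => ?_⟩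
    rw [Nat.add_assoc, List.getElem?_append_right (Nat.le_add_right ..), Nat.add_sub_cancel_left,
      hs i hi]

theorem flatten {l : List (Trace T V)} (h : ∀ w ∈ l, SwapsContiguous w) :
    SwapsContiguous l.flatten := by
  induction l with
  | nil => simp [SwapsContiguous]
  | cons w l ih =>
    rw [List.forall_mem_cons] at h
    exact h.1.append (ih h.2)

theorem of_mem_orderedStar {ι : Type*} [LT ι] {W : ι → Language (T × Label V)}
    (h : ∀ i, ∀ w ∈ W i, SwapsContiguous w) {w : Trace T V} (hw : w ∈ orderedStar W) :
    SwapsContiguous w := by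
  obtain ⟨l, -, hl, rfl⟩ := hw
  refine flatten fun w hw => ?_
  obtain ⟨x, hx, rfl⟩ := List.mem_map.1 hw
  exact h _ _ (hl x hx)

theorem of_forall_notMem {w : Trace T V} (h : ∀ t j v, (t, Label.deqSwap j (some v)) ∉ w) :
    SwapsContiguous w :=
  fun _ t j v hk => absurd (List.mem_of_getElem? hk) (h t j v)

theorem of_mem_deqT {t : T} {w : Trace T V} (hw : w ∈ deqT t) : SwapsContiguous w := by
  obtain ⟨r, n, v, rfl⟩ := hw
  intro k u j x hk
  have h_null (i : ℕ) (hi : i < n) :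
      ((t, Label.deqRead r) :: nullSwaps t n ++
        [(t, .deqSwap n (some v)), (t, .deqRet v)])[1 + i]? = some (t, .deqSwap i none) := by
    rw [Nat.add_comm]
    simp [nullSwaps, List.getElem?_append, hi]
  obtain ⟨h_pos, rfl, rfl, rfl⟩ : k = 1 + n ∧ u = t ∧ j = n ∧ x = v := by
    grind [nullSwaps]
  exact ⟨1, h_pos, h_null⟩

theorem of_mem_quotientExpr [LinearOrder T] (h : τ ∈ quotientExpr T V) : SwapsContiguous τ := by
  obtain ⟨l, rfl, hl⟩ := Language.mem_kstar.1 h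
  refine flatten fun w hw => ?_
  obtain ⟨_, ⟨_, ⟨w₁, h₁, w₂, ⟨l₂, -, h₂⟩, rfl⟩, w₃, h₃, rfl⟩, w₄, h₄, rfl⟩ := hl w hw
  refine ((append ?_ ?_).append ?_).append (of_mem_orderedStar (fun _ _ => of_mem_deqT) h₄)
  · refine of_mem_orderedStar ?_ h₁
    rintro t _ ⟨r, n, rfl⟩
    exact of_forall_notMem (by simp [nullSwaps])
  · refine of_mem_orderedStar (W := enqI) ?_ ⟨l₂, h₂⟩
    rintro t _ ⟨v, i, rfl⟩
    exact of_forall_notMem (by simp)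
  · refine of_mem_orderedStar ?_ h₃
    rintro i _ ⟨t, v, rfl⟩
    exact of_forall_notMem (by simp)

end SwapsContiguous

variable [DecidableEq T] {g : LoopGuard}

theorem SwapsContiguous.exists_dequeue_before (h : SwapsContiguous τ) (hτ : τ ∈ traces T V g)
    {e : Enqueue τ} {d : Dequeue τ} (h_slot : e.slot < d.slot) (h_write : e.write < d.swap) :
    ∃ d' : Dequeue τ, d'.slot = e.slot ∧ d'.swap < d.swap := by
  obtain ⟨s, h_swap, h_null⟩ := h _ _ _ _ d.getElem?_swap
  have h_lt : e.write < s + e.slot := by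
    by_contra! h_le
    have h_write_null := h_null (e.write - s) (by lia)
    rw [Nat.add_sub_cancel' (by lia), e.getElem?_write] at h_write_null
    simp at h_write_null
  obtain ⟨d', h_slot', h_lt'⟩ := exists_dequeue_of_null_swap hτ h_lt (h_null _ h_slot)
  exact ⟨d', h_slot', by lia⟩

theorem WritesOrdered.exists_dequeue_before (h : WritesOrdered τ) (hτ : τ ∈ traces T V g)
    {e e' : Enqueue τ} {d : Dequeue τ} (h_slot : e'.slot < e.slot) (h_write : e.write < e'.write)
    (h_swap : e'.write < d.swap) : ∃ d' : Dequeue τ, d'.slot = e.slot ∧ d'.swap < d.swap := by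
  obtain ⟨k, t, v, -, h_lt, hk⟩ := h _ _ _ _ _ _ _ _ _ _ _ _ h_write h_swap h_slot
    e.getElem?_write e'.getElem?_write d.getElem?_swap
  obtain ⟨d', -, -, h_slot', rfl⟩ := exists_dequeue_of_deqSwap hτ hk
  exact ⟨d', h_slot', h_lt⟩

theorem isFixedPoints_extend_effect (hτ : τ ∈ traces T V g) :
    IsFixedPoints τ (Function.extend Operation.thread (Operation.effect : Operation τ → ℕ) 0) := by
  rintro t ⟨a, ha⟩
  obtain ⟨o, rfl⟩ := exists_operation hτ ha
  rw [Operation.thread_injective.extend_apply]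
  obtain e | d := o
  · exact .inl ⟨_, _, e.getElem?_write⟩
  · exact .inr ⟨_, _, d.getElem?_swap⟩

theorem exists_isFixedPoints_isLinearization (hτ : τ ∈ traces T V g)
    (h_scan : SwapsContiguous τ) (h_order : WritesOrdered τ) :
    ∃ (lp : T → ℕ) (L : List T), IsFixedPoints τ lp ∧ IsLinearization τ lp L := by
  suffices ∃ L, IsLinearization τ _ L from
    let ⟨L, hL⟩ := this
    ⟨_, L, isFixedPoints_extend_effect hτ, hL⟩
  refine exists_isLinearization hτ Operation.effect_injective le_of_lt
    (fun o => ⟨o.effect, le_rfl, o.exists_getElem?_effect⟩) Operation.effect_lt_ret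
    (write_lt_swap hτ) fun {e e' d} h_slot h_write => ?_
  have h_swap := write_lt_swap hτ h_slot
  obtain h_lt | h_eq | h_lt := lt_trichotomy e.slot e'.slot
  · exact h_scan.exists_dequeue_before hτ (h_slot ▸ h_lt) (h_write.trans h_swap)
  · exact absurd h_write (Enqueue.eq_of_slot_eq hτ h_eq ▸ lt_irrefl _)
  · exact h_order.exists_dequeue_before hτ h_lt h_write h_swap

end Quotient

section Precedence

theorem deq_mem_of_queueRun_of_mem {A B : List V} {h₁ h₂ : List (Op V)} {x y : V} (h_ne : x ≠ y)
    (hx : x ∉ A) (h : QueueRun (A ++ y :: B) (h₁ ++ .deq x :: h₂)) : .deq y ∈ h₁ := by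
  induction h₁ generalizing A B with
  | nil =>
    obtain ⟨q, hq, -⟩ := h
    cases A <;> simp_all
  | cons o h₁ ih =>
    cases o with
    | enq v =>
      rw [List.cons_append, QueueRun, List.append_assoc] at h
      exact List.mem_cons_of_mem _ (ih hx h)
    | deq v =>
      obtain ⟨q, hq, h⟩ := h
      cases A with
      | nil => simp_all
      | cons w A =>
        obtain rfl := (List.cons.inj hq).2
        exact List.mem_cons_of_mem _ (ih (fun h => hx (List.mem_cons_of_mem _ h)) h)

theorem deq_mem_of_queueRun {q : List V} {h₁ h₂ g₁ g₂ : List (Op V)} {x y : V} (h_ne : x ≠ y)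
    (hq : x ∉ q) (hx : .enq x ∉ h₁) (h : QueueRun q (h₁ ++ .enq y :: h₂))
    (h_eq : h₁ ++ .enq y :: h₂ = g₁ ++ .deq x :: g₂) : .deq y ∈ g₁ := by
  induction h₁ generalizing q g₁ with
  | nil =>
    cases g₁ with
    | nil => simp at h_eq
    | cons o g₁ =>
      obtain ⟨rfl, rfl⟩ := List.cons.inj h_eq
      exact List.mem_cons_of_mem _ (deq_mem_of_queueRun_of_mem h_ne hq h)
  | cons o h₁ ih =>
    rw [List.mem_cons, not_or] at hx
    cases g₁ with
    | nil =>
      obtain ⟨rfl, -⟩ := List.cons.inj h_eq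
      obtain ⟨q, rfl, -⟩ := h
      simp at hq
    | cons o' g₁ =>
      obtain ⟨rfl, h_tail⟩ := List.cons.inj h_eq
      refine List.mem_cons_of_mem _ ?_
      cases o with
      | enq v => exact ih (by simp_all) hx.2 h h_tail
      | deq v =>
        obtain ⟨q, rfl, h⟩ := h
        exact ih (fun h => hq (List.mem_cons_of_mem _ h)) hx.2 h h_tail

theorem precedes_iff_exists_append {L : List T} {t u : T} :
    Precedes L t u ↔ ∃ L₁ L₂, L = L₁ ++ t :: L₂ ∧ u ∈ L₂ := by
  constructor
  · rintro ⟨k, m, h_lt, hk, hm⟩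
    obtain ⟨hk_lt, rfl⟩ := List.getElem?_eq_some_iff.1 hk
    refine ⟨L.take k, L.drop (k + 1), by simp, List.mem_of_getElem? (i := m - (k + 1)) ?_⟩
    rwa [List.getElem?_drop, Nat.add_sub_cancel' h_lt]
  · rintro ⟨L₁, L₂, rfl, hu⟩
    obtain ⟨m, hm⟩ := List.mem_iff_getElem?.1 hu
    exact ⟨L₁.length, L₁.length + (m + 1), by lia, by simp,
      by simpa [List.getElem?_append_right] using hm⟩

theorem precedes_or_precedes {L : List T} {t u : T} (ht : t ∈ L) (hu : u ∈ L) (h_ne : t ≠ u) :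
    Precedes L t u ∨ Precedes L u t := by
  obtain ⟨k, hk⟩ := List.mem_iff_getElem?.1 ht
  obtain ⟨m, hm⟩ := List.mem_iff_getElem?.1 hu
  obtain h_lt | rfl | h_lt := lt_trichotomy k m
  · exact .inl ⟨k, m, h_lt, hk, hm⟩
  · exact absurd (Option.some.inj (hk.symm.trans hm)) h_ne
  · exact .inr ⟨m, k, h_lt, hm, hk⟩

namespace IsLinearization

variable {lp : T → ℕ} {L : List T}

theorem lp_le_of_precedes (hL : IsLinearization τ lp L) {t u : T} (h : Precedes L t u) :
    lp t ≤ lp u := by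
  obtain ⟨L₁, L₂, rfl, hu⟩ := precedes_iff_exists_append.1 h
  exact (List.pairwise_cons.1 (List.pairwise_append.1 hL.sorted).2.1).1 u hu

theorem lp_lt_of_append {τ₁ τ₂ : Trace T V} (hL : IsLinearization (τ₁ ++ τ₂) lp L) {t u : T}
    (ht : t ∈ L) (hu : u ∈ L) (ht' : ∀ a, (t, a) ∉ τ₂) (hu' : ∀ a, (u, a) ∉ τ₁) :
    lp t < lp u := by
  obtain ⟨k, a, h_lt, hk, -⟩ := hL.before_return t ht
  obtain ⟨m, b, h_le, hm⟩ := hL.after_start u hu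
  have hk_lt : k < τ₁.length := by
    by_contra! h
    rw [List.getElem?_append_right h] at hk
    exact ht' a (List.mem_of_getElem? hk)
  have hm_le : τ₁.length ≤ m := by
    by_contra! h
    rw [List.getElem?_append_left h] at hm
    exact hu' b (List.mem_of_getElem? hm)
  lia

variable [DecidableEq T] {g : LoopGuard}

theorem exists_operations (hL : IsLinearization τ lp L) (hτ : τ ∈ traces T V g) :
    ∃ l : List (Operation τ), l.map Operation.thread = L ∧ QueueRun [] (l.map Operation.op) := by
  obtain ⟨ops, h_ops, h_run⟩ := hL.legal
  have h_mem : L ∈ Set.range (List.map (Operation.thread : Operation τ → T)) := by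
    rw [Set.range_list_map]
    intro t ht
    obtain ⟨a, ha⟩ := (hL.mem_iff t).1 ht
    exact exists_operation hτ ha
  obtain ⟨l, rfl⟩ := h_mem
  obtain rfl : ops = l.map Operation.op := by
    rw [← List.forall₂_eq_eq_eq, List.forall₂_map_right_iff]
    exact (List.forall₂_map_left_iff.1 h_ops).flip.imp fun _ _ h => Operation.opOf_iff.1 h
  exact ⟨l, rfl, h_run⟩

theorem exists_deq_precedes (hL : IsLinearization τ lp L) (hτ : τ ∈ traces T V g) {t u d : T}
    {x y : V} (h_ne : x ≠ y) (ht : OpOf τ t (.enq y)) (hu : ∀ t', OpOf τ t' (.enq x) → t' = u)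
    (h : Precedes L t u) (hd : OpOf τ d (.deq x)) :
    ∃ d', OpOf τ d' (.deq y) ∧ Precedes L d' d := by
  obtain ⟨l, rfl, h_run⟩ := hL.exists_operations hτ
  obtain ⟨L₁, L₂, h_eq, hu_mem⟩ := precedes_iff_exists_append.1 h
  obtain ⟨l₁, l₁', rfl, rfl, h_tail⟩ := List.map_eq_append_iff.1 h_eq
  obtain ⟨o, l₂, rfl, rfl, rfl⟩ := List.map_eq_cons_iff.1 h_tail
  obtain ⟨p, hp, rfl⟩ := List.mem_map.1 ((hL.mem_iff d).2 ⟨_, hd⟩)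
  obtain ⟨m₁, m₂, h_split⟩ := List.append_of_mem hp
  have h_enq_notMem : .enq x ∉ l₁.map Operation.op := by
    intro h_enq
    obtain ⟨o', ho', h_op⟩ := List.mem_map.1 h_enq
    have hu₁ : u ∈ l₁.map Operation.thread :=
      hu _ (Operation.opOf_iff.2 h_op.symm) ▸ List.mem_map_of_mem ho'
    have h_nodup := hL.nodup
    rw [List.map_append, List.map_cons] at h_nodup
    exact List.disjoint_of_nodup_append h_nodup hu₁ (List.mem_cons_of_mem _ hu_mem)
  have h_deq : .deq y ∈ m₁.map Operation.op := by
    refine deq_mem_of_queueRun (q := []) (h₂ := l₂.map Operation.op) (g₂ := m₂.map Operation.op)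
      h_ne List.not_mem_nil h_enq_notMem ?_ ?_
    all_goals rw [Operation.opOf_iff.1 ht, ← List.map_cons, ← List.map_append]
    · exact h_run
    · rw [h_split, List.map_append, List.map_cons, Operation.opOf_iff.1 hd]
  obtain ⟨p', hp', h_op⟩ := List.mem_map.1 h_deq
  obtain ⟨n₁, n₂, rfl⟩ := List.append_of_mem hp'
  refine ⟨p'.thread, Operation.opOf_iff.2 h_op.symm, precedes_iff_exists_append.2
    ⟨n₁.map Operation.thread, (n₂ ++ p :: m₂).map Operation.thread, ?_, by simp⟩⟩
  rw [h_split]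
  simp

end IsLinearization

end Precedence

section Future

/-- Enqueues of `a` and `b` return while a dequeue has passed the slot of `a`. Two enqueues of `c`
have reserved slots `2` and `3`; the one in slot `3` only serves to let scans with either loop guard
reach slot `2`. -/
def branchPrefix (e : ℕ → T) (a b c : V) : Trace T V :=
  [(e 1, .enqI a 0), (e 2, .enqI b 1), (e 3, .enqI c 2), (e 4, .enqI c 3),
   (e 5, .deqRead 3), (e 5, .deqSwap 0 none),
   (e 1, .enqW 0 a), (e 1, .enqRet), (e 2, .enqW 1 b), (e 2, .enqRet)]

/-- An entire dequeue that finds `a`, to be followed by `branchSndDeq`. -/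
def branchFstDeq (e : ℕ → T) (a : V) : Trace T V :=
  [(e 6, .deqRead 3), (e 6, .deqSwap 0 (some a)), (e 6, .deqRet a)]

/-- An entire dequeue that finds `b`, after which the dequeue pending in `branchPrefix` finds
`c`. -/
def branchSndDeq (e : ℕ → T) (b c : V) : Trace T V :=
  [(e 7, .deqRead 3), (e 7, .deqSwap 0 none), (e 7, .deqSwap 1 (some b)), (e 7, .deqRet b),
   (e 3, .enqW 2 c), (e 3, .enqRet), (e 4, .enqW 3 c), (e 4, .enqRet),
   (e 5, .deqSwap 1 none), (e 5, .deqSwap 2 (some c)), (e 5, .deqRet c)]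

/-- The dequeue pending in `branchPrefix` finds `b`; the value `a` is never removed. -/
def branchPendingDeq (e : ℕ → T) (b c : V) : Trace T V :=
  [(e 5, .deqSwap 1 (some b)), (e 5, .deqRet b),
   (e 3, .enqW 2 c), (e 3, .enqRet), (e 4, .enqW 3 c), (e 4, .enqRet)]

theorem LoopGuard.holds_of_lt (g : LoopGuard) {j r : ℕ} (h : j < r) : g.Holds j r := by
  cases g
  · exact h
  · exact h.le

theorem precedes_or_precedes_of_isLinearization_branchPrefix {e : ℕ → T}
    (he : Function.Injective e) {a b c : V} {σ : Trace T V} {lp : T → ℕ} {L : List T}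
    (hL : IsLinearization (branchPrefix e a b c ++ σ) lp L) :
    Precedes L (e 1) (e 2) ∨ Precedes L (e 2) (e 1) :=
  precedes_or_precedes ((hL.mem_iff _).2 ⟨.enqI a 0, by simp [branchPrefix]⟩)
    ((hL.mem_iff _).2 ⟨.enqI b 1, by simp [branchPrefix]⟩) (he.ne (by decide))

variable [DecidableEq T]

/-- The calls made in the traces that start with `branchPrefix`. -/
def branchEnv (e : ℕ → T) (a b c : V) : Env T V := fun t =>
  if t = e 1 then some (.enq a) else if t = e 2 then some (.enq b) else
  if t = e 3 then some (.enq c) else if t = e 4 then some (.enq c) else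
  if t = e 5 then some .deq else if t = e 6 then some .deq else
  if t = e 7 then some .deq else none

theorem finite_branchEnv_ne_none (e : ℕ → T) (a b c : V) :
    {t | branchEnv e a b c t ≠ none}.Finite := by
  refine (Set.toFinite {e 1, e 2, e 3, e 4, e 5, e 6, e 7}).subset fun t ht => ?_
  by_contra h_notMem
  simp only [Set.mem_insert_iff, Set.mem_singleton_iff, not_or] at h_notMem
  exact ht (by simp [branchEnv, h_notMem])

/-- From the shared state `(n, f)` and the local states `loc`, the steps `τ` can be executed and
complete every call that has started. Its introduction rules below execute a concrete trace step by
step. -/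
def Completes (g : LoopGuard) (env : Env T V) (n : ℕ) (f : ℕ → Option V)
    (loc : T → Option (LocalState V)) (τ : Trace T V) : Prop :=
  ∃ c, Exec g env ⟨⟨n, f⟩, loc⟩ τ c ∧ c.Final

namespace Completes

variable {g : LoopGuard} {env : Env T V} {n : ℕ} {f : ℕ → Option V}
  {loc : T → Option (LocalState V)} {t : T} {v : V} {i j r : ℕ} {τ : Trace T V}

theorem cons {a : Label V} {l l' : LocalState V} {s' : Shared V}
    (hl : (loc t).or ((env t).map Call.entry) = some l) (hs : ThreadStep g l ⟨n, f⟩ a l' s')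
    (h : Completes g env s'.back s'.items (Function.update loc t (some l')) τ) :
    Completes g env n f loc ((t, a) :: τ) :=
  h.imp fun _ h => ⟨.cons hl hs h.1, h.2⟩

theorem enqI (hl : (loc t).or ((env t).map Call.entry) = some (.enqStart v))
    (h : Completes g env (n + 1) f (Function.update loc t (some (.enqReserved v n))) τ) :
    Completes g env n f loc ((t, .enqI v n) :: τ) :=
  cons hl (.enqI _ _) h

theorem enqW_enqRet (hl : loc t = some (.enqReserved v i))
    (h : Completes g env n (Function.update f i (some v))
      (Function.update loc t (some .finished)) τ) :
    Completes g env n f loc ((t, .enqW i v) :: (t, .enqRet) :: τ) :=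
  cons (by rw [hl]; rfl) (.enqW _ _ _) (cons (by simp) (.enqRet _) (by simpa using h))

theorem deqRead (hl : (loc t).or ((env t).map Call.entry) = some .deqHead) (hr : r < n)
    (h : Completes g env n f (Function.update loc t (some (.deqScan r 0))) τ) :
    Completes g env n f loc ((t, .deqRead r) :: τ) :=
  cons hl (.deqRead _ _ hr) h

theorem deqSwap_none (hl : loc t = some (.deqScan r j)) (hj : j < r) (hf : f j = none)
    (h : Completes g env n f (Function.update loc t (some (.deqScan r (j + 1)))) τ) :
    Completes g env n f loc ((t, .deqSwap j none) :: τ) :=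
  cons (by rw [hl]; rfl) (.deqSwapNull _ _ _ (g.holds_of_lt hj) hf)
    (by rw [← hf]; simpa using h)

theorem deqSwap_deqRet (hl : loc t = some (.deqScan r j)) (hj : j < r) (hf : f j = some v)
    (h : Completes g env n (Function.update f j none)
      (Function.update loc t (some .finished)) τ) :
    Completes g env n f loc ((t, .deqSwap j (some v)) :: (t, .deqRet v) :: τ) :=
  cons (by rw [hl]; rfl) (.deqSwapVal _ _ _ _ (g.holds_of_lt hj) hf)
    (cons (by simp) (.deqRet _ _) (by simpa using h))

end Completes

theorem branches_mem_traces (g : LoopGuard) {e : ℕ → T} (he : Function.Injective e) (a b c : V) :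
    branchPrefix e a b c ++ (branchFstDeq e a ++ branchSndDeq e b c) ∈ traces T V g ∧
      branchPrefix e a b c ++ branchPendingDeq e b c ∈ traces T V g := by
  constructor <;>
  · refine ⟨branchEnv e a b c, finite_branchEnv_ne_none e a b c, ?_⟩
    simp only [branchPrefix, branchFstDeq, branchSndDeq, branchPendingDeq, List.cons_append,
      List.nil_append]
    change Completes g _ 0 (fun _ => none) (fun _ => none) _
    repeat
      first
      | refine Completes.enqI (by simp [branchEnv, he.eq_iff, Call.entry]) ?_
      | refine Completes.enqW_enqRet (by simp [he.eq_iff]) ?_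
      | refine Completes.deqRead (by simp [branchEnv, he.eq_iff, Call.entry]) (by decide) ?_
      | refine Completes.deqSwap_none (r := 3) (by simp [he.eq_iff]) (by decide) (by simp) ?_
      | refine Completes.deqSwap_deqRet (r := 3) (by simp [he.eq_iff]) (by decide) (by simp) ?_
    refine ⟨_, .nil _, fun t l => ?_⟩
    simp only [Function.update_apply]
    grind

variable {g : LoopGuard} {e : ℕ → T} {a b c : V} {lp : T → ℕ} {L : List T}

/-- If `b` were enqueued before `a`, the dequeue of `b` by `e 7` would precede that of `a` by `e 6`,
but the latter returns before the former starts. -/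
theorem precedes_of_isLinearization_branchFstDeq (he : Function.Injective e)
    (hab : a ≠ b) (hac : a ≠ c) (hbc : b ≠ c)
    (hτ : branchPrefix e a b c ++ (branchFstDeq e a ++ branchSndDeq e b c) ∈ traces T V g)
    (hL : IsLinearization (branchPrefix e a b c ++ (branchFstDeq e a ++ branchSndDeq e b c)) lp L) :
    Precedes L (e 1) (e 2) := by
  refine (precedes_or_precedes_of_isLinearization_branchPrefix he hL).resolve_right
    fun h => ?_
  obtain ⟨d, hd, h_before⟩ := hL.exists_deq_precedes hτ (d := e 6) hab
    ⟨1, by simp [branchPrefix]⟩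
    (by simp [OpOf, branchPrefix, branchFstDeq, branchSndDeq, hab, hac]) h
    (by simp [OpOf, branchFstDeq])
  obtain rfl : d = e 7 := by
    simpa [OpOf, branchPrefix, branchFstDeq, branchSndDeq, hab.symm, hbc] using hd
  have h_le : lp (e 7) ≤ lp (e 6) := hL.lp_le_of_precedes h_before
  have h_mem₆ : e 6 ∈ L := (hL.mem_iff _).2 ⟨.deqRet a, by simp [branchFstDeq]⟩
  have h_mem₇ : e 7 ∈ L := (hL.mem_iff _).2 ⟨_, hd⟩
  rw [← List.append_assoc] at hL
  have h_lt : lp (e 6) < lp (e 7) := hL.lp_lt_of_append h_mem₆ h_mem₇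
    (by simp [branchSndDeq, he.eq_iff]) (by simp [branchPrefix, branchFstDeq, he.eq_iff])
  exact h_lt.not_ge h_le

theorem precedes_of_isLinearization_branchPendingDeq (he : Function.Injective e)
    (hab : a ≠ b) (hbc : b ≠ c)
    (hτ : branchPrefix e a b c ++ branchPendingDeq e b c ∈ traces T V g)
    (hL : IsLinearization (branchPrefix e a b c ++ branchPendingDeq e b c) lp L) :
    Precedes L (e 2) (e 1) := by
  refine (precedes_or_precedes_of_isLinearization_branchPrefix he hL).resolve_left
    fun h => ?_
  obtain ⟨d, hd, -⟩ := hL.exists_deq_precedes hτ (d := e 5) hab.symm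
    ⟨0, by simp [branchPrefix]⟩
    (by simp [OpOf, branchPrefix, branchPendingDeq, hab.symm, hbc]) h
    (by simp [OpOf, branchPendingDeq])
  simp [OpOf, branchPrefix, branchPendingDeq, hab] at hd

theorem exists_precedes_of_append [Infinite T] (g : LoopGuard) (hab : a ≠ b) (hac : a ≠ c)
    (hbc : b ≠ c) :
    ∃ (π σ₁ σ₂ : Trace T V) (t₁ t₂ : T),
      π ++ σ₁ ∈ traces T V g ∧ π ++ σ₂ ∈ traces T V g ∧
      (t₁, Label.enqRet) ∈ π ∧ (t₂, Label.enqRet) ∈ π ∧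
      (∀ (lp : T → ℕ) (L : List T), IsLinearization (π ++ σ₁) lp L → Precedes L t₁ t₂) ∧
      (∀ (lp : T → ℕ) (L : List T), IsLinearization (π ++ σ₂) lp L → Precedes L t₂ t₁) := by
  have he : Function.Injective (Infinite.natEmbedding T) := (Infinite.natEmbedding T).injective
  obtain ⟨h₁, h₂⟩ := branches_mem_traces g he a b c
  exact ⟨_, _, _, _, _, h₁, h₂, by simp [branchPrefix], by simp [branchPrefix],
    fun _ _ => precedes_of_isLinearization_branchFstDeq he hab hac hbc h₁,
    fun _ _ => precedes_of_isLinearization_branchPendingDeq he hab hbc h₂⟩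

end Future

end HerlihyWing

theorem mainTheorem12 (T V : Type*) [LinearOrder T] [Infinite T] (g : HerlihyWing.LoopGuard) :
    -- the queue is linearizable
    (∀ τ ∈ HerlihyWing.traces T V g, HerlihyWing.Linearizable τ) ∧
    -- fixed linearization points on the traces of the quotient expression
    (∀ τ ∈ HerlihyWing.traces T V g,
      τ ∈ HerlihyWing.quotientExpr T V → HerlihyWing.WritesOrdered τ →
        ∃ (lp : T → ℕ) (L : List T),
          HerlihyWing.IsFixedPoints τ lp ∧ HerlihyWing.IsLinearization τ lp L) ∧
    -- on arbitrary traces the linearization order of two completed enqueues depends on the future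
    (∀ a b c : V, a ≠ b → a ≠ c → b ≠ c →
      ∃ (π σ₁ σ₂ : HerlihyWing.Trace T V) (t₁ t₂ : T),
        π ++ σ₁ ∈ HerlihyWing.traces T V g ∧ π ++ σ₂ ∈ HerlihyWing.traces T V g ∧
        (t₁, HerlihyWing.Label.enqRet) ∈ π ∧ (t₂, HerlihyWing.Label.enqRet) ∈ π ∧
        (∀ (lp : T → ℕ) (L : List T), HerlihyWing.IsLinearization (π ++ σ₁) lp L →
          HerlihyWing.Precedes L t₁ t₂) ∧
        (∀ (lp : T → ℕ) (L : List T), HerlihyWing.IsLinearization (π ++ σ₂) lp L →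
          HerlihyWing.Precedes L t₂ t₁)) :=
  ⟨fun _ hτ => HerlihyWing.linearizable hτ,
    fun _ hτ h_mem h_order => HerlihyWing.exists_isFixedPoints_isLinearization hτ
      (.of_mem_quotientExpr h_mem) h_order,
    fun _ _ _ hab hac hbc => HerlihyWing.exists_precedes_of_append g hab hac hbc⟩
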